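/- Let $p>1$ be an integer. For $z=r e^{i\theta}$ with $r>0$, $-\pi<\theta\le\pi$, and $j\in\{0,\dots,p-1\}$, let $f_j(z)=r^{1/p}e^{i(\theta+2\pi j)/p}$ be the $(j+1)$st branch of the $p$th root, and let $$f_j^{(k)}(z)=\frac1{p^k}\prod_{i=0}^{k-1}(1-ip)\; r^{(1-kp)/p}\,e^{i[2\pi j+\theta(1-kp)]/p}$$ be its derivatives (on the negative axis, continued from above). For a Jordan block $J_m(\lambda)$, $\lambda\ne0$, let $f_j(J_m(\lambda))$ be the upper triangular matrix with $(a,b)$ entry $f_j^{(b-a)}(\lambda)/(b-a)!$ for $a\le b$. For $\operatorname{Im}\lambda\neq0$ let $C_m(\lambda)\in M_{2m}(\mathbb R)$ be the real Jordan block with diagonal blocks $C(\lambda)=\begin{bmatrix}\operatorname{Re}\lambda&\operatorname{Im}\lambda\\-\operatorname{Im}\lambda&\operatorname{Re}\lambda\end{bmatrix}$ and superdiagonal blocks $I_2$, and put $$F_{(j_1,j_2)}(C_m(\lambda))=S_mP_m\begin{bmatrix}f_{j_1}(J_m(\lambda))&0\\0&f_{j_2}(J_m(\bar\lambda))\end{bmatrix}P_m^{T}S_m^{-1},$$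 where $S_m$ is the direct sum of $m$ copies of $\begin{bmatrix}-i&-i\\1&-1\end{bmatrix}$ and $P_m$ is the permutation matrix with columns $e_1,e_3,\dots,e_{2m-1},e_2,e_4,\dots,e_{2m}$. Let $A\in M_n(\mathbb R)$ be nonsingular and primitive (entrywise nonnegative with some positive power entrywise positive), with spectral radius $\rho$, and let $$A=R\Big[\rho\ \oplus\ \bigoplus_{k=2}^{r}J_{n_k}(\lambda_k)\ \oplus\ \bigoplus_{k=r+1}^{r+c}C_{n_k}(\lambda_k)\Big]R^{-1}$$ with $R$ real and invertible, all $n_k\ge 1$, $\lambda_k$ real for $2\le k\le r$, and $\operatorname{Im}\lambda_k\ne0$ for $k>r$. Let $$X_j=R\Big[f_{j_1}(\rho)\ \oplus\ \bigoplus_{k=2}^{r}f_{j_k}(J_{n_k}(\lambda_k))\ \oplus\ \bigoplus_{k=r+1}^{r+c}F_{j_k}(C_{n_k}(\lambda_k))\Big]R^{-1}$$ be a primary $p$th root of $A$; here $j_k=(j_{k_1},j_{k_2})$ for $k>r$, all indices lie in $\{0,\dots,p-1\}$, and complex Jordan blocks with the same eigenvalue carry the same index (for $k>r$, $j_{k_1}$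 belongs to $\lambda_k$ and $j_{k_2}$ to $\bar\lambda_k$). Call a complex matrix eventually positive if it is real and all its sufficiently high powers are entrywise positive. If $p$ is odd, then $X_j$ is eventually positive if and only if 1. $j_1=0$; 2. for all $k=2,\dots,r$: $j_k=0$ if $\lambda_k>0$, and $j_k=(p-1)/2$ if $\lambda_k<0$ (the branch with $f_{j_k}(\lambda_k)=-|\lambda_k|^{1/p}$); and 3. for all $k=r+1,\dots,r+c$: $j_k=(0,0)$ or $j_k=(j_{k_1},p-j_{k_1})$. If $p$ is even and $A$ has no negative eigenvalue, then $X_j$ is eventually positive if and only if 1. $j_1=0$; 2. $j_k=0$ or $j_k=p/2$ for all $k=2,\dots,r$; and 3. $j_k=(0,0)$ or $j_k=(j_{k_1},p-j_{k_1})$ for all $k=r+1,\dots,r+c$. If $p$ is even and $A$ has a negative eigenvalue, then no such $X_j$ is eventually positive. -/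

import Mathlib

open Matrix Complex
open scoped Kronecker ComplexConjugate

noncomputable section

namespace MatrixRoot

/-- A real square matrix is eventually positive if all sufficiently high powers are entrywise
positive. -/
def EventuallyPositive {n : ℕ} (B : Matrix (Fin n) (Fin n) ℝ) : Prop :=
  ∃ N : ℕ, ∀ k ≥ N, ∀ a b, 0 < (B ^ k) a b

/-- A complex matrix is eventually positive if it is a real matrix (all its entries are real) and
that real matrix is eventually positive. -/
def IsEventuallyPositive {n : ℕ} (X : Matrix (Fin n) (Fin n) ℂ) : Prop :=
  ∃ B : Matrix (Fin n) (Fin n) ℝ, X = B.map ofReal ∧ EventuallyPositive B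

/-- The spectral radius of a real matrix, i.e. the largest modulus of a complex eigenvalue. -/
def rho {n : ℕ} (A : Matrix (Fin n) (Fin n) ℝ) : ℝ :=
  (spectralRadius ℂ (A.map ofReal)).toReal

/-- The branch `f_j` of the `p`-th root: for `z = r exp(iθ)` with `θ = arg z ∈ (-π, π]`,
`f_j(z) = r^(1/p) exp(i (θ + 2πj) / p)`. -/
def rootBranch (p j : ℕ) (z : ℂ) : ℂ :=
  ((‖z‖ ^ ((1 : ℝ) / p) : ℝ) : ℂ) * exp (I * ((arg z + 2 * Real.pi * j) / p))

/-- The `k`-th derivative of `f_j` at `z = r exp(iθ) ≠ 0`: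
`p^(-k) ∏_{i<k} (1 - ip) r^((1-kp)/p) exp(i [2πj + θ(1-kp)] / p)`.
On the negative real axis (`θ = π`) this is the derivative of the branch continued from above. -/
def rootBranchDeriv (p j k : ℕ) (z : ℂ) : ℂ :=
  (1 / (p : ℂ) ^ k) * (∏ i ∈ Finset.range k, (1 - (i : ℂ) * p)) *
    (((‖z‖ ^ ((1 - (k : ℝ) * p) / p) : ℝ) : ℂ) *
      exp (I * ((2 * Real.pi * j + arg z * (1 - k * p)) / p)))

/-- The derivative of order zero is the branch itself. -/
theorem rootBranchDeriv_zero (p j : ℕ) (z : ℂ) :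
    rootBranchDeriv p j 0 z = rootBranch p j z := by
  simp [rootBranchDeriv, rootBranch, add_comm]

/-- The Jordan block `J_m(x)`: `x` on the diagonal and ones on the superdiagonal. -/
def jordanBlock {K : Type*} [Zero K] [One K] (m : ℕ) (x : K) : Matrix (Fin m) (Fin m) K :=
  of fun a b => if a = b then x else if (a : ℕ) + 1 = b then 1 else 0

/-- `f_j(J_m(x))`: the upper triangular Toeplitz matrix whose `(a, b)` entry, `a ≤ b`, is
`f_j^{(b-a)}(x) / (b-a)!`. -/
def rootJordanBlock (p j m : ℕ) (x : ℂ) : Matrix (Fin m) (Fin m) ℂ :=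
  of fun a b => if a ≤ b then
    rootBranchDeriv p j ((b : ℕ) - a) x / ((Nat.factorial ((b : ℕ) - a) : ℕ) : ℂ) else 0

/-- The real `2 × 2` matrix `C(z)` with rows `(Re z, Im z)` and `(-Im z, Re z)`. -/
def realPair (z : ℂ) : Matrix (Fin 2) (Fin 2) ℝ :=
  !![z.re, z.im; -z.im, z.re]

/-- The real Jordan block `C_m(z)` of size `2m`: `m` diagonal blocks `C(z)` and identity blocks
`I_2` on the block superdiagonal. The index `(a, s)` is row `s` of block row `a`. -/
def realJordanBlock (m : ℕ) (z : ℂ) : Matrix (Fin m × Fin 2) (Fin m × Fin 2) ℝ :=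
  of fun x y => if x.1 = y.1 then realPair z x.2 y.2
    else if (x.1 : ℕ) + 1 = y.1 then (1 : Matrix (Fin 2) (Fin 2) ℝ) x.2 y.2 else 0

/-- The direct sum `S_m` of `m` copies of the matrix `S` with rows `(-i, -i)` and `(1, -1)`. -/
def matS (m : ℕ) : Matrix (Fin m × Fin 2) (Fin m × Fin 2) ℂ :=
  (1 : Matrix (Fin m) (Fin m) ℂ) ⊗ₖ !![-I, -I; 1, -1]

/-- The permutation matrix `P_m` with columns `e_1, e_3, …, e_{2m-1}, e_2, e_4, …, e_{2m}`:
the first `m` columns are indexed by `Sum.inl`, the last `m` by `Sum.inr`. -/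
def matP (m : ℕ) : Matrix (Fin m × Fin 2) (Fin m ⊕ Fin m) ℂ :=
  of fun x y => if x = Sum.elim (fun a => (a, 0)) (fun a => (a, 1)) y then 1 else 0

/-- `F_{(j₁, j₂)}(C_m(z)) = S_m P_m (f_{j₁}(J_m(z)) ⊕ f_{j₂}(J_m(z̄))) P_mᵀ S_m⁻¹`. -/
def rootRealJordanBlock (p j₁ j₂ m : ℕ) (z : ℂ) : Matrix (Fin m × Fin 2) (Fin m × Fin 2) ℂ :=
  matS m * matP m *
    fromBlocks (rootJordanBlock p j₁ m z) 0 0 (rootJordanBlock p j₂ m (conj z)) *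
    (matP m)ᵀ * (matS m)⁻¹

/-- Row indices of a matrix consisting of a `1 × 1` block, `s` blocks of sizes `m k`, and
`c` blocks of sizes `2 * q k`. -/
abbrev BlockIdx {s c : ℕ} (m : Fin s → ℕ) (q : Fin c → ℕ) : Type :=
  Unit ⊕ ((Σ k : Fin s, Fin (m k)) ⊕ (Σ k : Fin c, Fin (q k) × Fin 2))

/-- The direct sum of a `1 × 1` block, `s` blocks of sizes `m k` and `c` blocks of sizes
`2 * q k`. -/
def directSum {K : Type*} [Zero K] {s c : ℕ} {m : Fin s → ℕ} {q : Fin c → ℕ} (x : K)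
    (M : ∀ k, Matrix (Fin (m k)) (Fin (m k)) K)
    (Q : ∀ k, Matrix (Fin (q k) × Fin 2) (Fin (q k) × Fin 2) K) :
    Matrix (BlockIdx m q) (BlockIdx m q) K :=
  fromBlocks (of fun _ _ => x) 0 0 (fromBlocks (blockDiagonal' M) 0 0 (blockDiagonal' Q))

/-- The real Jordan matrix `(x) ⊕ ⨁ J_{m k}(lam k) ⊕ ⨁ C_{q k}(μ k)`. -/
def realJordanForm {s c : ℕ} (x : ℝ) (m : Fin s → ℕ) (lam : Fin s → ℝ) (q : Fin c → ℕ)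
    (μ : Fin c → ℂ) : Matrix (BlockIdx m q) (BlockIdx m q) ℝ :=
  directSum x (fun k => jordanBlock (m k) (lam k)) (fun k => realJordanBlock (q k) (μ k))

/-- The matrix `(f_{j₁}(x)) ⊕ ⨁ f_{jr k}(J_{m k}(lam k)) ⊕ ⨁ F_{jc k}(C_{q k}(μ k))`. -/
def rootRealJordanForm {s c : ℕ} (p : ℕ) (x : ℝ) (m : Fin s → ℕ) (lam : Fin s → ℝ)
    (q : Fin c → ℕ) (μ : Fin c → ℂ) (j₁ : Fin p) (jr : Fin s → Fin p)
    (jc : Fin c → Fin p × Fin p) : Matrix (BlockIdx m q) (BlockIdx m q) ℂ :=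
  directSum (rootBranch p j₁ x) (fun k => rootJordanBlock p (jr k) (m k) (lam k))
    (fun k => rootRealJordanBlock p (jc k).1 (jc k).2 (q k) (μ k))

/-- The branches chosen define a primary root: all complex Jordan blocks (with eigenvalues
`x`, `lam k`, `μ k`, `conj (μ k)`) that have the same eigenvalue are given the same branch. -/
def IsPrimaryChoice {s c p : ℕ} (x : ℝ) (lam : Fin s → ℝ) (μ : Fin c → ℂ) (j₁ : Fin p)
    (jr : Fin s → Fin p) (jc : Fin c → Fin p × Fin p) : Prop :=
  Function.FactorsThrough
    (Sum.elim (fun _ : Unit => j₁)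
      (Sum.elim jr (Sum.elim (fun k => (jc k).1) (fun k => (jc k).2))))
    (Sum.elim (fun _ : Unit => (x : ℂ))
      (Sum.elim (fun k => (lam k : ℂ)) (Sum.elim μ (fun k => conj (μ k)))))

end MatrixRoot

end

open MatrixRoot

/-!
Everything happens in the Jordan basis. Conjugation by the real matrix `R` preserves realness, so
`X` is real iff each block of its Jordan part is real. All derivatives of a branch `f_j` at `z` are
real multiples of the one unimodular number `exp (i (arg z + 2πj) / p)` times a power of
`exp (-i arg z)` (`exists_rootBranchDeriv_eq`). Hence a block `f_j (J_m(x))`, `x` real, is real iff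
its diagonal is, and `F_{(j, j')}(C_m(z))` is real iff `f_{j'}(z̄)` is the conjugate of `f_j(z)`.
These are conditions on angles: `j = 0` or `2j = p` for `x > 0`, `2j + 1 = p` for `x < 0`, and
`j + j' ∈ {0, p}` for a conjugate pair.

It remains to see when a real root is eventually positive. By Perron-Frobenius theory for the
primitive matrix `A` (`eigenvector_of_norm_eq`, `perron_mul_pos`, `perron_unique`), the eigenvalues
of all the other blocks have modulus less than `ρ`, and the spectral projection `E` of the Perron
eigenvalue, the product of a column of `R` and a row of `R⁻¹`, is entrywise positive
(`perron_jordan`). Moduli of the eigenvalues of `X` are `p`-th roots of those of `A`, so with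
`t = f_{j₁}(ρ)` the matrices `t⁻ᵏ Xᵏ` converge to the same `E`. Thus a real `X` is eventually
positive iff `t > 0`, that is iff `j₁ = 0`; if `t < 0`, the large odd powers of `X` are negative
(`eventuallyPositive_iff_of_tendsto`).

The Perron-Frobenius facts rest on one consequence of Gelfand's formula: powers of a matrix with
spectrum in the open unit disc tend to zero. It forbids `A ^ N` to expand, in every coordinate, a
vector with a positive entry by more than `ρ ^ N`. So for an eigenvector `v` to an eigenvalue of
modulus `ρ` the triangle inequality `ρ ^ N |v| ≤ A ^ N |v|` is an equality, and `A ^ N > 0` makes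
all entries of `v` nonzero and of one direction.
-/

open Filter Topology

namespace MatrixRoot

/-! ### Powers of matrices with small spectrum -/

theorem map_ofReal_mulVec {ι : Type*} [Fintype ι] (A : Matrix ι ι ℝ) (x : ι → ℝ) :
    (A.map ofReal *ᵥ fun i => (x i : ℂ)) = fun i => ((A *ᵥ x) i : ℂ) := by
  ext i
  simp [mulVec, dotProduct]

section PerronFrobenius

variable {ι : Type*} [Fintype ι] [DecidableEq ι]

/-- By Gelfand's formula, the powers of a complex matrix whose spectrum lies in the open unit disc
tend to zero. -/
theorem tendsto_pow_zero_of_spectrum (M : Matrix ι ι ℂ) (h : ∀ z ∈ spectrum ℂ M, ‖z‖ < 1) :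
    Tendsto (fun k => M ^ k) atTop (𝓝 0) := by
  rcases isEmpty_or_nonempty ι with hι | hι
  · exact tendsto_const_nhds.congr fun k => Subsingleton.elim _ _
  let : NormedRing (Matrix ι ι ℂ) := Matrix.linftyOpNormedRing
  let : NormedAlgebra ℂ (Matrix ι ι ℂ) := Matrix.linftyOpNormedAlgebra
  have : CompleteSpace (Matrix ι ι ℂ) := FiniteDimensional.complete ℂ _
  have hlt : spectralRadius ℂ M < (1 : NNReal) :=
    spectrum.spectralRadius_lt_of_forall_lt M fun z hz => by
      simpa [← NNReal.coe_lt_coe] using h z hz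
  obtain ⟨r, hr, hr1⟩ := ENNReal.lt_iff_exists_nnreal_btwn.1 hlt
  have hev := (spectrum.pow_nnnorm_pow_one_div_tendsto_nhds_spectralRadius M).eventually_lt_const hr
  have hr1' : (r : ℝ) < 1 := by exact_mod_cast hr1
  refine (tendsto_zero_iff_norm_tendsto_zero (E := Matrix ι ι ℂ)).2 ?_
  refine squeeze_zero' (Eventually.of_forall fun _ => norm_nonneg _) ?_
    (tendsto_pow_atTop_nhds_zero_of_lt_one r.2 hr1')
  filter_upwards [hev, eventually_gt_atTop 0] with k hk hk0
  have hk' : (0 : ℝ) < k := by exact_mod_cast hk0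
  have h1 : (‖M ^ k‖₊ : ENNReal) ≤ (r : ENNReal) ^ k := by
    have := ENNReal.rpow_le_rpow hk.le hk'.le
    rwa [← ENNReal.rpow_mul, one_div, inv_mul_cancel₀ hk'.ne', ENNReal.rpow_one,
      ENNReal.rpow_natCast] at this
  exact_mod_cast h1

theorem map_ofReal_pow (A : Matrix ι ι ℝ) (k : ℕ) :
    (A ^ k).map ofReal = (A.map ofReal) ^ k :=
  map_pow (Complex.ofRealHom.mapMatrix (m := ι)) A k

/-- The form of `tendsto_pow_zero_of_spectrum` for powers scaled by a dominating number. -/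
theorem tendsto_inv_smul_pow_zero (M : Matrix ι ι ℂ) (a : ℂ)
    (h : ∀ z ∈ spectrum ℂ M, ‖z‖ < ‖a‖) :
    Tendsto (fun k => (a⁻¹ • M) ^ k) atTop (𝓝 0) := by
  refine tendsto_pow_zero_of_spectrum _ fun z hz => ?_
  rcases eq_or_ne a 0 with rfl | ha
  -- `0⁻¹ • M` is the zero matrix, whose only possible eigenvalue is `0`
  · have : z = 0 := by
      by_contra hz0
      rw [_root_.inv_zero, zero_smul, spectrum.mem_iff, sub_zero] at hz
      exact hz ((IsUnit.mk0 z hz0).map (algebraMap ℂ (Matrix ι ι ℂ)))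
    simp [this]
  · have hmem : a * z ∈ spectrum ℂ M := by
      have := spectrum.unit_smul_eq_smul M (Units.mk0 a ha)⁻¹
      have h2 : a⁻¹ • M = (Units.mk0 a ha)⁻¹ • M := by
        rw [Units.smul_def]; simp
      rw [h2, this, Set.mem_smul_set] at hz
      obtain ⟨w, hw, rfl⟩ := hz
      rw [Units.smul_def]
      simpa [ha] using hw
    have := h _ hmem
    rw [norm_mul] at this
    have ha' : 0 < ‖a‖ := norm_pos_iff.2 ha
    nlinarith

theorem mem_spectrum_of_mulVec {M : Matrix ι ι ℂ} {v : ι → ℂ} {z : ℂ} (hv : v ≠ 0)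
    (h : M *ᵥ v = z • v) : z ∈ spectrum ℂ M := by
  rw [← Matrix.spectrum_toLin', ← Module.End.hasEigenvalue_iff_mem_spectrum]
  exact Module.End.hasEigenvalue_of_hasEigenvector
    ⟨Module.End.mem_eigenspace_iff.2 (by simpa using h), hv⟩

theorem norm_le_rho {n : ℕ} (A : Matrix (Fin n) (Fin n) ℝ) {z : ℂ}
    (hz : z ∈ spectrum ℂ (A.map ofReal)) : ‖z‖ ≤ rho A := by
  let : NormedRing (Matrix (Fin n) (Fin n) ℂ) := Matrix.linftyOpNormedRing
  let : NormedAlgebra ℂ (Matrix (Fin n) (Fin n) ℂ) := Matrix.linftyOpNormedAlgebra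
  have : CompleteSpace (Matrix (Fin n) (Fin n) ℂ) := FiniteDimensional.complete ℂ _
  have hfin : spectralRadius ℂ (A.map ofReal) ≠ ⊤ := by
    refine ne_top_of_le_ne_top ?_ (spectrum.spectralRadius_le_pow_nnnorm_pow_one_div ℂ _ 0)
    simp [ENNReal.mul_eq_top]
  have h : (‖z‖₊ : ENNReal) ≤ spectralRadius ℂ (A.map ofReal) :=
    le_iSup₂ (f := fun (k : ℂ) (_ : k ∈ spectrum ℂ (A.map ofReal)) => (‖k‖₊ : ENNReal)) z hz
  have := ENNReal.toReal_mono hfin h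
  simpa [rho] using this

theorem spectrum_transpose (M : Matrix ι ι ℂ) : spectrum ℂ Mᵀ = spectrum ℂ M := by
  ext z
  rw [Matrix.mem_spectrum_iff_isRoot_charpoly, Matrix.mem_spectrum_iff_isRoot_charpoly,
    Matrix.charpoly_transpose]

/-! ### Perron-Frobenius theory of primitive matrices -/

theorem isPrimitive_transpose {A : Matrix ι ι ℝ} (hA : A.IsPrimitive) : Aᵀ.IsPrimitive := by
  obtain ⟨h0, N, hN, h⟩ := hA
  exact ⟨fun i j => h0 j i, N, hN, fun i j => by
    rw [← transpose_pow, transpose_apply]; exact h j i⟩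

theorem mulVec_pow_of_mulVec {R : Type*} [CommRing R] {M : Matrix ι ι R} {v : ι → R} {z : R}
    (h : M *ᵥ v = z • v) (k : ℕ) : (M ^ k) *ᵥ v = z ^ k • v := by
  induction k with
  | zero => simp
  | succ k ih =>
    rw [pow_succ, ← mulVec_mulVec, h, mulVec_smul, ih, smul_smul, pow_succ, mul_comm]

/-- If a nonnegative matrix `B` is expanded by the factor `a` on a positive vector, so are its
powers. -/
theorem pow_smul_le_pow_mulVec {B : Matrix ι ι ℝ} (hB : ∀ i j, 0 ≤ B i j) {u : ι → ℝ} {a : ℝ}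
    (ha : 0 ≤ a) (h : ∀ i, a * u i ≤ (B *ᵥ u) i) (k : ℕ) (i : ι) :
    a ^ k * u i ≤ ((B ^ k) *ᵥ u) i := by
  induction k generalizing i with
  | zero => simp
  | succ k ih =>
    rw [pow_succ' B, ← mulVec_mulVec, pow_succ' a, mul_assoc]
    have h1 := mul_le_mul_of_nonneg_left (h i) (pow_nonneg ha k)
    calc a * (a ^ k * u i) = a ^ k * (a * u i) := by ring
      _ ≤ a ^ k * (B *ᵥ u) i := h1
      _ = ∑ j, B i j * (a ^ k * u j) := by
        simp only [mulVec, dotProduct, Finset.mul_sum]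
        exact Finset.sum_congr rfl fun j _ => by ring
      _ ≤ (B *ᵥ ((B ^ k) *ᵥ u)) i :=
        Finset.sum_le_sum fun j _ => mul_le_mul_of_nonneg_left (ih j) (hB i j)

/-- Extremality of the spectral radius: no vector with a positive entry can be expanded by `A ^ N`
by more than the factor `ρ ^ N` in every coordinate. -/
theorem not_forall_pow_mul_lt {A : Matrix ι ι ℝ} {ρ : ℝ} (hρ : 0 ≤ ρ)
    (hspec : ∀ z ∈ spectrum ℂ (A.map ofReal), ‖z‖ ≤ ρ) {N : ℕ} (hN : 0 < N)
    (hpos : ∀ i j, 0 < (A ^ N) i j) {u : ι → ℝ} {i₀ : ι} (hu : 0 < u i₀) :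
    ¬ ∀ i, ρ ^ N * u i < ((A ^ N) *ᵥ u) i := by
  intro hlt
  -- by continuity the strict inequalities survive for some `σ > ρ`, although `(σ⁻¹ A) ^ k → 0`
  have hev : ∀ᶠ σ in 𝓝[>] ρ, ∀ i, σ ^ N * u i < ((A ^ N) *ᵥ u) i := by
    rw [eventually_all]
    intro i
    have hc : ContinuousAt (fun σ : ℝ => σ ^ N * u i) ρ := by fun_prop
    exact (hc.eventually_lt continuousAt_const (hlt i)).filter_mono nhdsWithin_le_nhds
  obtain ⟨σ, hσ, hρσ⟩ := (hev.and self_mem_nhdsWithin).exists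
  have hρσ : ρ < σ := hρσ
  have hσ0 : 0 < σ := hρ.trans_lt hρσ
  have ht := tendsto_inv_smul_pow_zero (A.map ofReal) (σ : ℂ) fun z hz => by
    rw [Complex.norm_real, Real.norm_of_nonneg hσ0.le]
    exact (hspec z hz).trans_lt hρσ
  have ht2 : Tendsto (fun k : ℕ => (((((σ : ℂ)⁻¹ • A.map ofReal) ^ (N * k)) *ᵥ
      (fun i => (u i : ℂ))) i₀).re) atTop (𝓝 0) := by
    have h1 : Continuous fun M : Matrix ι ι ℂ => ((M *ᵥ (fun i => (u i : ℂ))) i₀).re := by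
      fun_prop
    have h2 := (h1.tendsto 0).comp
      (ht.comp (tendsto_id.const_mul_atTop' hN))
    simpa [Function.comp_def] using h2
  have hge : ∀ k : ℕ, u i₀ ≤ (((((σ : ℂ)⁻¹ • A.map ofReal) ^ (N * k)) *ᵥ
      (fun i => (u i : ℂ))) i₀).re := by
    intro k
    have h1 := pow_smul_le_pow_mulVec (fun i j => (hpos i j).le) (pow_nonneg hσ0.le N)
      (fun i => (hσ i).le) k i₀
    have h2 : ((σ : ℂ)⁻¹ • A.map ofReal) ^ (N * k)
        = ((σ⁻¹ ^ (N * k) • A ^ (N * k)).map ofReal) := by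
      rw [smul_pow, ← map_ofReal_pow]
      ext a b
      simp
    rw [h2]
    have h3 : (((σ⁻¹ ^ (N * k) • A ^ (N * k)).map ofReal) *ᵥ (fun i => (u i : ℂ))) i₀
        = ((σ⁻¹ ^ (N * k) * (((A ^ N) ^ k) *ᵥ u) i₀ : ℝ) : ℂ) := by
      simp [mulVec, dotProduct, Finset.mul_sum, pow_mul, mul_assoc]
    rw [h3, ofReal_re, inv_pow, ← div_eq_inv_mul, le_div_iff₀ (by positivity), mul_comm, pow_mul]
    exact h1
  exact absurd (ge_of_tendsto' ht2 hge) (not_le.2 hu)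

/-- The moduli of an eigenvector to an eigenvalue of maximal modulus form an eigenvector of the
positive power of the matrix. -/
theorem pow_mulVec_norm {A : Matrix ι ι ℝ} {ρ : ℝ} (hρ : 0 ≤ ρ)
    (hspec : ∀ z ∈ spectrum ℂ (A.map ofReal), ‖z‖ ≤ ρ) {N : ℕ} (hN : 0 < N)
    (hpos : ∀ i j, 0 < (A ^ N) i j) {v : ι → ℂ} {z : ℂ} (hz : ‖z‖ = ρ)
    (hv : (A ^ N).map ofReal *ᵥ v = z ^ N • v) (i : ι) :
    ((A ^ N) *ᵥ fun j => ‖v j‖) i = ρ ^ N * ‖v i‖ := by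
  have hle : ∀ i, ρ ^ N * ‖v i‖ ≤ ((A ^ N) *ᵥ fun j => ‖v j‖) i := by
    intro i
    have h1 : ρ ^ N * ‖v i‖ = ‖((A ^ N).map ofReal *ᵥ v) i‖ := by rw [hv]; simp [hz]
    rw [h1]
    refine (norm_sum_le _ _).trans (Finset.sum_le_sum fun j _ => ?_)
    have h2 : ‖(((A ^ N) i j : ℝ) : ℂ) * v j‖ = (A ^ N) i j * ‖v j‖ := by
      rw [norm_mul, Complex.norm_real, Real.norm_of_nonneg (hpos i j).le]
    exact h2.le
  by_contra hne
  have hlt : ρ ^ N * ‖v i‖ < ((A ^ N) *ᵥ fun j => ‖v j‖) i := lt_of_le_of_ne (hle i) (Ne.symm hne)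
  -- one more application of `A ^ N > 0` makes the inequality strict in every coordinate
  refine not_forall_pow_mul_lt hρ hspec hN hpos (u := (A ^ N) *ᵥ fun j => ‖v j‖) (i₀ := i)
    (lt_of_le_of_lt (by positivity) hlt) fun a => ?_
  have h2 : ρ ^ N * ((A ^ N) *ᵥ fun j => ‖v j‖) a = ∑ j, (A ^ N) a j * (ρ ^ N * ‖v j‖) := by
    simp only [mulVec, dotProduct, Finset.mul_sum]
    exact Finset.sum_congr rfl fun j _ => by ring
  rw [h2]
  exact Finset.sum_lt_sum (fun j _ => mul_le_mul_of_nonneg_left (hle j) (hpos a j).le)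
    ⟨i, Finset.mem_univ _, mul_lt_mul_of_pos_left hlt (hpos a i)⟩

/-- Equality in the triangle inequality: an eigenvector of a primitive matrix to an eigenvalue `z`
of maximal modulus has no zero entry and is a multiple of the vector of its moduli; hence `z` is the
spectral radius itself. -/
theorem eigenvector_of_norm_eq {A : Matrix ι ι ℝ} (hA : A.IsPrimitive) {ρ : ℝ} (hρ : 0 < ρ)
    (hspec : ∀ z ∈ spectrum ℂ (A.map ofReal), ‖z‖ ≤ ρ) {v : ι → ℂ} (hv0 : v ≠ 0) {z : ℂ}
    (hz : ‖z‖ = ρ) (hv : A.map ofReal *ᵥ v = z • v) :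
    z = ρ ∧ (∀ i, v i ≠ 0) ∧ ∃ c : ℂ, ∀ i, v i = c * ‖v i‖ := by
  obtain ⟨hnn, N, hN, hpos⟩ := hA
  have hvN : (A ^ N).map ofReal *ᵥ v = z ^ N • v := by
    have := mulVec_pow_of_mulVec hv N
    rwa [← map_ofReal_pow] at this
  have heq := pow_mulVec_norm hρ.le hspec hN hpos hz hvN
  obtain ⟨i₀, hi₀⟩ := Function.ne_iff.1 hv0
  have hne : ∀ i, v i ≠ 0 := by
    intro i hi
    have h1 := heq i
    rw [hi, norm_zero, mul_zero] at h1
    have h2 : 0 < ((A ^ N) *ᵥ fun j => ‖v j‖) i :=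
      Finset.sum_pos' (fun j _ => mul_nonneg (hpos i j).le (norm_nonneg _))
        ⟨i₀, Finset.mem_univ _, mul_pos (hpos i i₀) (norm_pos_iff.2 hi₀)⟩
    exact h2.ne' h1
  -- `S` is the common direction of all entries
  set S : ℂ := z ^ N * v i₀ with hS
  have hSsum : S = ∑ j, ((A ^ N) i₀ j : ℂ) * v j := by
    have := congrFun hvN i₀
    simpa [mulVec, dotProduct, hS] using this.symm
  have hSn : ‖S‖ = ∑ j, (A ^ N) i₀ j * ‖v j‖ := by
    have := heq i₀
    simp only [mulVec, dotProduct] at this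
    rw [this, hS, norm_mul, norm_pow, hz]
  have hS0 : 0 < ‖S‖ := by
    rw [hS, norm_mul, norm_pow, hz]
    have := norm_pos_iff.2 (hne i₀)
    positivity
  have hterm : ∀ j, (conj S * v j).re = ‖S‖ * ‖v j‖ := by
    have hle : ∀ j, (conj S * v j).re ≤ ‖S‖ * ‖v j‖ := fun j =>
      (Complex.re_le_norm _).trans (by rw [norm_mul, RCLike.norm_conj])
    have hsum : ∑ j, (A ^ N) i₀ j * (conj S * v j).re
        = ∑ j, (A ^ N) i₀ j * (‖S‖ * ‖v j‖) := by
      have h1 : ∑ j, (A ^ N) i₀ j * (conj S * v j).re = (conj S * S).re := by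
        conv_rhs => rw [mul_comm, hSsum, Finset.sum_mul, Complex.re_sum]
        rw [← hSsum]
        refine Finset.sum_congr rfl fun j _ => ?_
        rw [mul_assoc, Complex.re_ofReal_mul, mul_comm (v j)]
      have h2 : ∑ j, (A ^ N) i₀ j * (‖S‖ * ‖v j‖) = ‖S‖ * ‖S‖ := by
        conv_rhs => enter [2]; rw [hSn]
        rw [Finset.mul_sum]
        exact Finset.sum_congr rfl fun j _ => by ring
      rw [h1, h2, mul_comm, Complex.mul_conj, Complex.normSq_eq_norm_sq, ofReal_re, sq]
    have := (Finset.sum_eq_sum_iff_of_le fun j _ =>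
      mul_le_mul_of_nonneg_left (hle j) (hpos i₀ j).le).1 hsum
    exact fun j => mul_left_cancel₀ (hpos i₀ j).ne' (this j (Finset.mem_univ _))
  have hdir : ∀ j, v j = (S / ‖S‖) * ‖v j‖ := by
    intro j
    have hn : ‖conj S * v j‖ = ‖S‖ * ‖v j‖ := by rw [norm_mul, RCLike.norm_conj]
    have h1 : conj S * v j = ((‖S‖ * ‖v j‖ : ℝ) : ℂ) := by
      have him := (Complex.le_def.1 (Complex.re_eq_norm.1 ((hterm j).trans hn.symm))).2
      exact Complex.ext (by rw [ofReal_re, hterm j]) (by rw [ofReal_im, ← him]; rfl)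
    have h2 : S * conj S = (‖S‖ : ℂ) ^ 2 := by
      rw [Complex.mul_conj, Complex.normSq_eq_norm_sq]; push_cast; rfl
    have hS0' : (‖S‖ : ℂ) ≠ 0 := by exact_mod_cast hS0.ne'
    have h3 : (‖S‖ : ℂ) ^ 2 * v j = (‖S‖ : ℂ) ^ 2 * ((S / ‖S‖) * ‖v j‖) := by
      rw [← h2, mul_assoc, h1, h2]
      push_cast
      field_simp
    exact mul_left_cancel₀ (pow_ne_zero 2 hS0') h3
  refine ⟨?_, hne, _, hdir⟩
  -- the moduli form an eigenvector to `z`, so `z` is real and nonnegative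
  have hvn : (0 : ℝ) < ‖v i₀‖ := norm_pos_iff.2 (hne i₀)
  have hc0 : S / ‖S‖ ≠ 0 := by
    intro h0
    exact hne i₀ (by rw [hdir i₀, h0, zero_mul])
  have h1 : ((A *ᵥ fun j => ‖v j‖) i₀ : ℂ) = z * ‖v i₀‖ := by
    have h2 := congrFun hv i₀
    refine mul_left_cancel₀ hc0 ?_
    simp only [mulVec, dotProduct, map_apply, Pi.smul_apply, smul_eq_mul] at h2 ⊢
    calc (S / ‖S‖) * ((∑ j, A i₀ j * ‖v j‖ : ℝ) : ℂ)
        = ∑ j, (A i₀ j : ℂ) * ((S / ‖S‖) * ‖v j‖) := by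
          push_cast
          rw [Finset.mul_sum]
          exact Finset.sum_congr rfl fun j _ => by ring
      _ = ∑ j, (A i₀ j : ℂ) * v j := Finset.sum_congr rfl fun j _ => by rw [← hdir j]
      _ = z * v i₀ := h2
      _ = z * ((S / ‖S‖) * ‖v i₀‖) := by rw [← hdir i₀]
      _ = _ := by ring
  have h3 : z = (((A *ᵥ fun j => ‖v j‖) i₀ / ‖v i₀‖ : ℝ) : ℂ) := by
    have : (‖v i₀‖ : ℂ) ≠ 0 := by exact_mod_cast hvn.ne'
    push_cast
    rw [h1]
    field_simp
  have h4 : 0 ≤ (A *ᵥ fun j => ‖v j‖) i₀ / ‖v i₀‖ :=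
    div_nonneg (Finset.sum_nonneg fun j _ => mul_nonneg (hnn i₀ j) (norm_nonneg _)) hvn.le
  rw [← hz, h3, Complex.norm_real, Real.norm_of_nonneg h4]

/-- The entries of a real Perron vector are nonzero and of one sign. -/
theorem perron_mul_pos {A : Matrix ι ι ℝ} (hA : A.IsPrimitive) {ρ : ℝ} (hρ : 0 < ρ)
    (hspec : ∀ z ∈ spectrum ℂ (A.map ofReal), ‖z‖ ≤ ρ) {x : ι → ℝ} (hx0 : x ≠ 0)
    (hx : A *ᵥ x = ρ • x) (i j : ι) : 0 < x i * x j := by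
  have hv : A.map ofReal *ᵥ (fun i => (x i : ℂ)) = (ρ : ℂ) • fun i => (x i : ℂ) := by
    rw [map_ofReal_mulVec, hx]
    ext i
    simp
  have hv0 : (fun i => (x i : ℂ)) ≠ 0 := fun h =>
    hx0 (funext fun i => by simpa using congrFun h i)
  obtain ⟨-, hne, c, hc⟩ := eigenvector_of_norm_eq hA hρ hspec hv0
    (by rw [Complex.norm_real, Real.norm_of_nonneg hρ.le]) hv
  have hne' : ∀ i, x i ≠ 0 := fun i => by simpa using hne i
  have hc' : ∀ i, (x i : ℂ) = c * (|x i| : ℝ) := fun i => by simpa using hc i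
  have hi := hc' i
  have hj := hc' j
  have hc2 : c ^ 2 = 1 := by
    have h1 : (x i : ℂ) ^ 2 = c ^ 2 * (x i : ℂ) ^ 2 := by
      conv_lhs => rw [hi]
      rw [mul_pow, ← ofReal_pow, sq_abs, ofReal_pow]
    have h2 : (x i : ℂ) ^ 2 ≠ 0 := pow_ne_zero 2 (by exact_mod_cast hne' i)
    exact (mul_eq_right₀ h2).1 h1.symm
  have h3 : ((x i * x j : ℝ) : ℂ) = ((|x i| * |x j| : ℝ) : ℂ) := by
    push_cast
    rw [hi, hj]
    linear_combination (((|x i| : ℝ) : ℂ) * ((|x j| : ℝ) : ℂ)) * hc2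
  rw [ofReal_inj.1 h3]
  exact mul_pos (abs_pos.2 (hne' i)) (abs_pos.2 (hne' j))

/-- The Perron eigenvalue of a primitive matrix is geometrically simple. -/
theorem perron_unique {A : Matrix ι ι ℝ} (hA : A.IsPrimitive) {ρ : ℝ} (hρ : 0 < ρ)
    (hspec : ∀ z ∈ spectrum ℂ (A.map ofReal), ‖z‖ ≤ ρ) {x y : ι → ℝ} (hx0 : x ≠ 0)
    (hx : A *ᵥ x = ρ • x) (hy : A *ᵥ y = ρ • y) : ∃ t : ℝ, y = t • x := by
  obtain ⟨i, hi⟩ := Function.ne_iff.1 hx0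
  have hi : x i ≠ 0 := hi
  refine ⟨y i / x i, ?_⟩
  by_contra hne
  -- this combination vanishes at `i`, whereas a Perron vector has no zero entry
  have h := perron_mul_pos hA hρ hspec (x := y - (y i / x i) • x) (sub_ne_zero.2 hne)
    (by rw [mulVec_sub, mulVec_smul, hx, hy, smul_sub, smul_comm]) i i
  simp [hi] at h

end PerronFrobenius

/-! ### Branches of the root -/

/-- The unimodular factor `exp (i (arg z + 2πj) / p)` of the branch `f_j` at `z`. -/
noncomputable def rootPhase (p j : ℕ) (z : ℂ) : ℂ := exp (I * ((arg z + 2 * Real.pi * j) / p))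

theorem rootBranch_eq (p j : ℕ) (z : ℂ) :
    rootBranch p j z = ((‖z‖ ^ ((1 : ℝ) / p) : ℝ) : ℂ) * rootPhase p j z := rfl

theorem norm_rootPhase (p j : ℕ) (z : ℂ) : ‖rootPhase p j z‖ = 1 := by
  have : rootPhase p j z = exp (((arg z + 2 * Real.pi * j) / p : ℝ) * I) := by
    rw [rootPhase, mul_comm]; push_cast; rfl
  rw [this, Complex.norm_exp_ofReal_mul_I]

theorem norm_rootBranch (p j : ℕ) (z : ℂ) : ‖rootBranch p j z‖ = ‖z‖ ^ ((1 : ℝ) / p) := by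
  rw [rootBranch_eq, norm_mul, norm_rootPhase, mul_one, Complex.norm_real, Real.norm_of_nonneg]
  positivity

/-- All derivatives of a branch are real multiples of the phase times a power of
`exp (-i arg z)`. -/
theorem exists_rootBranchDeriv_eq {p : ℕ} (hp : p ≠ 0) (k : ℕ) (x : ℝ) :
    ∃ r : ℝ, ∀ (j : ℕ) (z : ℂ), ‖z‖ = x →
      rootBranchDeriv p j k z = r * rootPhase p j z * exp (-(I * arg z)) ^ k := by
  refine ⟨(1 / (p : ℝ) ^ k) * (∏ i ∈ Finset.range k, (1 - (i : ℝ) * p)) *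
    x ^ ((1 - (k : ℝ) * p) / p), fun j z hz => ?_⟩
  have hp' : (p : ℂ) ≠ 0 := by exact_mod_cast hp
  have h1 : exp (I * ((2 * Real.pi * j + arg z * (1 - k * p)) / p))
      = rootPhase p j z * exp (-(I * arg z)) ^ k := by
    rw [rootPhase, ← Complex.exp_nat_mul, ← Complex.exp_add]
    congr 1
    field_simp
    ring
  rw [rootBranchDeriv, h1, hz]
  push_cast
  ring

theorem rootBranch_im_eq_zero_iff {p j : ℕ} {z : ℂ} (hz : z ≠ 0) :
    (rootBranch p j z).im = 0 ↔ (rootPhase p j z).im = 0 := by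
  have : (0 : ℝ) < ‖z‖ ^ ((1 : ℝ) / p) := Real.rpow_pos_of_pos (norm_pos_iff.2 hz) _
  rw [rootBranch_eq, Complex.im_ofReal_mul, mul_eq_zero, or_iff_right this.ne']

theorem rootBranch_conj_iff {p j j' : ℕ} {z : ℂ} (hz : z ≠ 0) :
    rootBranch p j' (conj z) = conj (rootBranch p j z) ↔
      rootPhase p j' (conj z) = conj (rootPhase p j z) := by
  have : (0 : ℝ) < ‖z‖ ^ ((1 : ℝ) / p) := Real.rpow_pos_of_pos (norm_pos_iff.2 hz) _
  have h : ((‖z‖ ^ ((1 : ℝ) / p) : ℝ) : ℂ) ≠ 0 := by exact_mod_cast this.ne'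
  rw [rootBranch_eq, rootBranch_eq, map_mul, Complex.conj_ofReal, RCLike.norm_conj]
  exact ⟨fun h' => mul_left_cancel₀ h h', fun h' => by rw [h']⟩

theorem rootPhase_im_eq_zero_iff {p j : ℕ} (hp : 0 < p) (z : ℂ) :
    (rootPhase p j z).im = 0 ↔ ∃ n : ℤ, (n : ℝ) * Real.pi * p = arg z + 2 * Real.pi * j := by
  have h : rootPhase p j z = exp (((arg z + 2 * Real.pi * j) / p : ℝ) * I) := by
    rw [rootPhase, mul_comm]; push_cast; rfl
  have hp' : (p : ℝ) ≠ 0 := by exact_mod_cast hp.ne'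
  rw [h, Complex.exp_ofReal_mul_I_im, Real.sin_eq_zero_iff]
  exact exists_congr fun n => by rw [eq_div_iff hp']

theorem rootPhase_ofReal_pos {p j : ℕ} (hj : j < p) {x : ℝ} (hx : 0 < x) :
    (rootPhase p j x).im = 0 ↔ j = 0 ∨ 2 * j = p := by
  rw [rootPhase_im_eq_zero_iff (by omega), Complex.arg_ofReal_of_nonneg hx.le]
  have key : ∀ n : ℤ, ((n : ℝ) * Real.pi * p = 0 + 2 * Real.pi * j) ↔ n * p = 2 * j := by
    intro n
    rw [← @Int.cast_inj ℝ]
    push_cast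
    constructor
    · intro h
      exact mul_left_cancel₀ Real.pi_ne_zero (by linarith)
    · intro h
      linear_combination Real.pi * h
  simp only [key]
  constructor
  · rintro ⟨n, hn⟩
    have h0 : 0 ≤ n := by
      by_contra hneg
      nlinarith
    have h2 : n < 2 := by
      by_contra hge
      nlinarith
    interval_cases n
    · left; omega
    · right; omega
  · rintro (rfl | h)
    · exact ⟨0, by simp⟩
    · exact ⟨1, by omega⟩

theorem rootPhase_ofReal_neg {p j : ℕ} (hj : j < p) {x : ℝ} (hx : x < 0) :
    (rootPhase p j x).im = 0 ↔ 2 * j + 1 = p := by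
  rw [rootPhase_im_eq_zero_iff (by omega), Complex.arg_ofReal_of_neg hx]
  have key : ∀ n : ℤ, ((n : ℝ) * Real.pi * p = Real.pi + 2 * Real.pi * j) ↔
      n * p = 2 * j + 1 := by
    intro n
    rw [← @Int.cast_inj ℝ]
    push_cast
    constructor
    · intro h
      exact mul_left_cancel₀ Real.pi_ne_zero (by linarith)
    · intro h
      linear_combination Real.pi * h
  simp only [key]
  constructor
  · rintro ⟨n, hn⟩
    have h0 : 0 < n := by
      by_contra hneg
      nlinarith
    have h2 : n < 2 := by
      by_contra hge
      nlinarith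
    interval_cases n
    omega
  · intro h
    exact ⟨1, by omega⟩

theorem rootPhase_conj {p j j' : ℕ} (hj : j < p) (hj' : j' < p) {z : ℂ} (hz : z.im ≠ 0) :
    rootPhase p j' (conj z) = conj (rootPhase p j z) ↔ (j = 0 ∧ j' = 0) ∨ j + j' = p := by
  have hp : (p : ℂ) ≠ 0 := by
    have : p ≠ 0 := by omega
    exact_mod_cast this
  have harg : arg (conj z) = -arg z := by
    rw [Complex.arg_conj, if_neg]
    intro h
    exact hz (Complex.arg_eq_pi_iff.1 h).2
  have h1 : conj (rootPhase p j z) = exp (-(I * ((arg z + 2 * Real.pi * j) / p))) := by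
    rw [rootPhase, ← Complex.exp_conj]
    congr 1
    simp [Complex.conj_ofNat]
  rw [h1, rootPhase, harg, Complex.exp_eq_exp_iff_exists_int]
  have key : ∀ n : ℤ, (I * (((-arg z : ℝ) : ℂ) + 2 * Real.pi * j') / p =
      -(I * ((arg z + 2 * Real.pi * j) / p)) + n * (2 * Real.pi * I)) ↔
      (j : ℤ) + j' = n * p := by
    intro n
    rw [← @Int.cast_inj ℂ]
    have hpi : (2 * Real.pi * I : ℂ) ≠ 0 := Complex.two_pi_I_ne_zero
    push_cast
    constructor
    · intro h
      field_simp at h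
      refine mul_left_cancel₀ hpi ?_
      linear_combination I * h
    · intro h
      field_simp
      linear_combination 2 * (Real.pi : ℂ) * h
  simp only [mul_div_assoc] at key ⊢
  simp only [key]
  constructor
  · rintro ⟨n, hn⟩
    have h0 : 0 ≤ n := by
      by_contra hneg
      nlinarith
    have h2 : n < 2 := by
      by_contra hge
      nlinarith
    interval_cases n
    · left; omega
    · right; omega
  · rintro (⟨rfl, rfl⟩ | h)
    · exact ⟨0, by simp⟩
    · exact ⟨1, by omega⟩

/-! ### Roots of Jordan blocks -/

theorem rootJordanBlock_apply_self (p j m : ℕ) (x : ℂ) (a : Fin m) :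
    rootJordanBlock p j m x a a = rootBranch p j x := by
  simp [rootJordanBlock, rootBranchDeriv_zero]

/-- A primary root of a real Jordan block is real as soon as its diagonal is. -/
theorem rootJordanBlock_real_iff {p j m : ℕ} (hp : p ≠ 0) (hm : 0 < m) {x : ℝ} (hx : x ≠ 0) :
    (∀ a b, (rootJordanBlock p j m x a b).im = 0) ↔ (rootPhase p j x).im = 0 := by
  constructor
  · intro h
    have := h ⟨0, hm⟩ ⟨0, hm⟩
    rwa [rootJordanBlock_apply_self, rootBranch_im_eq_zero_iff (by exact_mod_cast hx)] at this
  · intro h a b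
    rw [rootJordanBlock, of_apply]
    split_ifs with hab
    · obtain ⟨r, hr⟩ := exists_rootBranchDeriv_eq hp ((b : ℕ) - a) ‖(x : ℂ)‖
      rw [hr j _ rfl]
      have h1 : exp (-(I * arg (x : ℂ))) = (((if 0 ≤ x then 1 else -1) : ℝ) : ℂ) := by
        split_ifs with h0
        · simp [Complex.arg_ofReal_of_nonneg h0]
        · rw [Complex.arg_ofReal_of_neg (not_le.1 h0), mul_comm, Complex.exp_neg,
            Complex.exp_pi_mul_I]
          simp
      obtain ⟨y, hy⟩ : ∃ y : ℝ, rootPhase p j x = y := ⟨_, Complex.ext rfl (by simpa using h)⟩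
      rw [h1, hy]
      norm_cast
    · simp

theorem rootBranchDeriv_conj {p j j' : ℕ} (hp : p ≠ 0) {z : ℂ} (hz : z.im ≠ 0)
    (h : rootPhase p j' (conj z) = conj (rootPhase p j z)) (k : ℕ) :
    rootBranchDeriv p j' k (conj z) = conj (rootBranchDeriv p j k z) := by
  have harg : arg (conj z) = -arg z := by
    rw [Complex.arg_conj, if_neg]
    intro h
    exact hz (Complex.arg_eq_pi_iff.1 h).2
  obtain ⟨r, hr⟩ := exists_rootBranchDeriv_eq hp k ‖z‖
  rw [hr j z rfl, hr j' (conj z) (RCLike.norm_conj z), h, map_mul, map_mul, map_pow,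
    ← Complex.exp_conj, harg]
  simp

theorem rootJordanBlock_conj {p j j' m : ℕ} (hp : p ≠ 0) {z : ℂ} (hz : z.im ≠ 0)
    (h : rootPhase p j' (conj z) = conj (rootPhase p j z)) (a b : Fin m) :
    rootJordanBlock p j' m (conj z) a b = conj (rootJordanBlock p j m z a b) := by
  simp only [rootJordanBlock, of_apply]
  split_ifs
  · rw [rootBranchDeriv_conj hp hz h, map_div₀, Complex.conj_natCast]
  · simp

/-- The inverse of `S_m`. -/
noncomputable def matSInv (m : ℕ) : Matrix (Fin m × Fin 2) (Fin m × Fin 2) ℂ :=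
  (1 : Matrix (Fin m) (Fin m) ℂ) ⊗ₖ !![I / 2, 1 / 2; I / 2, -1 / 2]

theorem matS_mul_matSInv (m : ℕ) : matS m * matSInv m = 1 := by
  have h : (!![-I, -I; 1, -1] : Matrix (Fin 2) (Fin 2) ℂ) * !![I / 2, 1 / 2; I / 2, -1 / 2]
      = 1 := by
    ext a b
    fin_cases a <;> fin_cases b <;> simp <;> ring_nf <;> simp
  rw [matS, matSInv, ← mul_kronecker_mul, h, one_mul, one_kronecker_one]

theorem matS_inv (m : ℕ) : (matS m)⁻¹ = matSInv m := inv_eq_right_inv (matS_mul_matSInv m)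

theorem matSInv_mul_matS (m : ℕ) : matSInv m * matS m = 1 :=
  mul_eq_one_comm.1 (matS_mul_matSInv m)

theorem matP_transpose_mul (m : ℕ) : (matP m)ᵀ * matP m = 1 := by
  ext x y
  simp only [mul_apply, transpose_apply, matP, of_apply, one_apply]
  rcases x with a | a <;> rcases y with b | b <;>
    simp [Fintype.sum_prod_type, Prod.ext_iff, ite_and, eq_comm]

theorem matP_mul_fromBlocks_mul (m : ℕ) (F G : Matrix (Fin m) (Fin m) ℂ) (a b : Fin m)
    (s t : Fin 2) :
    (matP m * fromBlocks F 0 0 G * (matP m)ᵀ) (a, s) (b, t) =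
      if s = t then (if s = 0 then F a b else G a b) else 0 := by
  simp only [mul_apply, transpose_apply, matP, of_apply, Fintype.sum_sum_type]
  fin_cases s <;> fin_cases t <;> simp [Prod.ext_iff]

/-- The `2 × 2` blocks of `S P (F ⊕ G) Pᵀ S⁻¹`. -/
theorem conj_matS_apply (m : ℕ) (F G : Matrix (Fin m) (Fin m) ℂ) (a b : Fin m) (s t : Fin 2) :
    (matS m * matP m * fromBlocks F 0 0 G * (matP m)ᵀ * (matS m)⁻¹) (a, s) (b, t) =
      (!![(F a b + G a b) / 2, (F a b - G a b) / (2 * I);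
        -((F a b - G a b) / (2 * I)), (F a b + G a b) / 2] : Matrix (Fin 2) (Fin 2) ℂ) s t := by
  have h : matS m * matP m * fromBlocks F 0 0 G * (matP m)ᵀ * (matS m)⁻¹
      = matS m * (matP m * fromBlocks F 0 0 G * (matP m)ᵀ) * matSInv m := by
    simp only [matS_inv, Matrix.mul_assoc]
  rw [h]
  generalize hD : matP m * fromBlocks F 0 0 G * (matP m)ᵀ = D
  have hD' : ∀ a b s t, D (a, s) (b, t) =
      if s = t then (if s = 0 then F a b else G a b) else 0 := fun a b s t => by
    rw [← hD, matP_mul_fromBlocks_mul]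
  simp only [mul_apply, matS, matSInv, kroneckerMap_apply, Fintype.sum_prod_type, Fin.sum_univ_two,
    hD', one_apply]
  fin_cases s <;> fin_cases t <;> simp [Finset.sum_add_distrib, ite_mul, mul_ite] <;>
    field_simp <;> ring_nf <;> simp <;> ring

/-- A primary root of a real Jordan block of a nonreal eigenvalue is real iff the two branches take
conjugate values. -/
theorem rootRealJordanBlock_real_iff {p j j' m : ℕ} (hp : p ≠ 0) (hm : 0 < m) {z : ℂ}
    (hz : z.im ≠ 0) :
    (∀ x y, (rootRealJordanBlock p j j' m z x y).im = 0) ↔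
      rootPhase p j' (conj z) = conj (rootPhase p j z) := by
  have hz0 : z ≠ 0 := fun h => hz (by simp [h])
  constructor
  · intro h
    have h1 := h (⟨0, hm⟩, 0) (⟨0, hm⟩, 0)
    have h2 := h (⟨0, hm⟩, 0) (⟨0, hm⟩, 1)
    simp only [rootRealJordanBlock, conj_matS_apply, rootJordanBlock_apply_self] at h1 h2
    rw [← rootBranch_conj_iff hz0]
    generalize rootBranch p j z = u at *
    generalize rootBranch p j' (conj z) = v at *
    simp [Complex.div_im, Complex.normSq_apply] at h1 h2
    apply Complex.ext
    · simp; linarith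
    · simp; linarith
  · rintro h ⟨a, s⟩ ⟨b, t⟩
    simp only [rootRealJordanBlock, conj_matS_apply, rootJordanBlock_conj hp hz h]
    generalize rootJordanBlock p j m z a b = u
    fin_cases s <;> fin_cases t <;> simp [Complex.div_im, Complex.normSq_apply]

/-! ### Convergence of scaled powers -/

theorem tendsto_rootJordanBlock_pow {p j m : ℕ} {x a : ℂ} (h : ‖rootBranch p j x‖ < ‖a‖) :
    Tendsto (fun k => (a⁻¹ • rootJordanBlock p j m x) ^ k) atTop (𝓝 0) := by
  refine tendsto_inv_smul_pow_zero _ a fun z hz => ?_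
  rw [Matrix.mem_spectrum_iff_isRoot_charpoly, Matrix.charpoly_of_isUpperTriangular,
    Polynomial.IsRoot.def, Polynomial.eval_prod, Finset.prod_eq_zero_iff] at hz
  · obtain ⟨i, -, hi⟩ := hz
    rw [rootJordanBlock_apply_self] at hi
    have : z = rootBranch p j x := by simpa [sub_eq_zero] using hi
    rwa [this]
  · intro a b hab
    have : ¬ a ≤ b := not_le.2 hab
    simp [rootJordanBlock, this]

theorem mul_mul_pow {ι κ : Type*} [Fintype ι] [DecidableEq ι] [Fintype κ] [DecidableEq κ]
    {U : Matrix ι κ ℂ} {V : Matrix κ ι ℂ} (hUV : U * V = 1) (hVU : V * U = 1) (D : Matrix κ κ ℂ)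
    (k : ℕ) : (U * D * V) ^ k = U * D ^ k * V := by
  induction k with
  | zero => simp [hUV]
  | succ k ih =>
    calc (U * D * V) ^ (k + 1) = U * D ^ k * (V * U) * D * V := by
          rw [pow_succ, ih]; simp only [Matrix.mul_assoc]
      _ = U * D ^ (k + 1) * V := by
          rw [hVU, pow_succ]; simp only [Matrix.mul_assoc, Matrix.one_mul]

theorem tendsto_rootRealJordanBlock_pow {p j j' m : ℕ} {x a : ℂ} (h : ‖rootBranch p j x‖ < ‖a‖)
    (h' : ‖rootBranch p j' (conj x)‖ < ‖a‖) :
    Tendsto (fun k => (a⁻¹ • rootRealJordanBlock p j j' m x) ^ k) atTop (𝓝 0) := by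
  set F := a⁻¹ • rootJordanBlock p j m x with hF
  set G := a⁻¹ • rootJordanBlock p j' m (conj x) with hG
  have hPP : matP m * (matP m)ᵀ = 1 := by
    ext ⟨b, s⟩ ⟨b', t⟩
    have := matP_mul_fromBlocks_mul m 1 1 b b' s t
    rw [fromBlocks_one, Matrix.mul_one] at this
    rw [this]
    by_cases hs : s = t <;> simp [one_apply, hs]
  have hUV : matS m * matP m * ((matP m)ᵀ * matSInv m) = 1 := by
    rw [Matrix.mul_assoc, ← Matrix.mul_assoc (matP m), hPP, Matrix.one_mul, matS_mul_matSInv]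
  have hVU : (matP m)ᵀ * matSInv m * (matS m * matP m) = 1 := by
    rw [Matrix.mul_assoc, ← Matrix.mul_assoc (matSInv m), matSInv_mul_matS, Matrix.one_mul,
      matP_transpose_mul]
  have hpow : ∀ k, (a⁻¹ • rootRealJordanBlock p j j' m x) ^ k =
      matS m * matP m * fromBlocks (F ^ k) 0 0 (G ^ k) * ((matP m)ᵀ * matSInv m) := by
    intro k
    rw [← fromBlocks_diagonal_pow, ← mul_mul_pow hUV hVU]
    congr 1
    have : fromBlocks F 0 0 G = a⁻¹ • fromBlocks (rootJordanBlock p j m x) 0 0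
        (rootJordanBlock p j' m (conj x)) := by
      rw [fromBlocks_smul, smul_zero]
    rw [this, rootRealJordanBlock, matS_inv, Matrix.mul_smul, Matrix.smul_mul]
    simp only [Matrix.mul_assoc]
  simp only [hpow]
  have hc : Continuous fun D : Matrix (Fin m) (Fin m) ℂ × Matrix (Fin m) (Fin m) ℂ =>
      matS m * matP m * fromBlocks D.1 0 0 D.2 * ((matP m)ᵀ * matSInv m) := by
    have : Continuous fun D : Matrix (Fin m) (Fin m) ℂ × Matrix (Fin m) (Fin m) ℂ =>
        fromBlocks D.1 0 0 D.2 := by fun_prop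
    exact (continuous_const.matrix_mul this).matrix_mul continuous_const
  have ht := (hc.tendsto (0, 0)).comp
    ((tendsto_rootJordanBlock_pow h).prodMk_nhds (tendsto_rootJordanBlock_pow (m := m) h'))
  simpa [Function.comp_def] using ht

theorem directSum_pow {s c : ℕ} {m : Fin s → ℕ} {q : Fin c → ℕ} (x : ℂ)
    (M : ∀ k, Matrix (Fin (m k)) (Fin (m k)) ℂ)
    (Q : ∀ k, Matrix (Fin (q k) × Fin 2) (Fin (q k) × Fin 2) ℂ) (n : ℕ) :
    directSum x M Q ^ n = directSum (x ^ n) (fun k => M k ^ n) (fun k => Q k ^ n) := by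
  have h : (of fun _ _ => x : Matrix Unit Unit ℂ) ^ n = of fun _ _ => x ^ n := by
    induction n with
    | zero => ext; simp
    | succ n ih => ext; simp [pow_succ, ih, mul_apply]
  rw [directSum, fromBlocks_diagonal_pow, fromBlocks_diagonal_pow, ← blockDiagonal'_pow,
    ← blockDiagonal'_pow, h]
  rfl

theorem smul_directSum {s c : ℕ} {m : Fin s → ℕ} {q : Fin c → ℕ} (a x : ℂ)
    (M : ∀ k, Matrix (Fin (m k)) (Fin (m k)) ℂ)
    (Q : ∀ k, Matrix (Fin (q k) × Fin 2) (Fin (q k) × Fin 2) ℂ) :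
    a • directSum x M Q = directSum (a * x) (fun k => a • M k) (fun k => a • Q k) := by
  ext (_ | ⟨k, i⟩ | ⟨k, i⟩) (_ | ⟨l, j⟩ | ⟨l, j⟩) <;> simp [directSum, blockDiagonal'_apply]

theorem tendsto_directSum {s c : ℕ} {m : Fin s → ℕ} {q : Fin c → ℕ}
    {M : ℕ → ∀ k, Matrix (Fin (m k)) (Fin (m k)) ℂ}
    {Q : ℕ → ∀ k, Matrix (Fin (q k) × Fin 2) (Fin (q k) × Fin 2) ℂ}
    (hM : ∀ k, Tendsto (fun n => M n k) atTop (𝓝 0))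
    (hQ : ∀ k, Tendsto (fun n => Q n k) atTop (𝓝 0)) :
    Tendsto (fun n => directSum (1 : ℂ) (M n) (Q n)) atTop
      (𝓝 (Matrix.single (Sum.inl ()) (Sum.inl ()) 1)) := by
  refine tendsto_pi_nhds.2 fun i => tendsto_pi_nhds.2 fun j => ?_
  rcases i with _ | ⟨k, i⟩ | ⟨k, i⟩ <;> rcases j with _ | ⟨l, j⟩ | ⟨l, j⟩ <;>
    simp [directSum, blockDiagonal'_apply]
  · split_ifs with h
    · subst h
      exact tendsto_pi_nhds.1 (tendsto_pi_nhds.1 (hM k) i) j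
    · simp
  · split_ifs with h
    · subst h
      exact tendsto_pi_nhds.1 (tendsto_pi_nhds.1 (hQ k) i) j
    · simp

/-! ### Perron-Frobenius theory in the real Jordan basis -/

section

variable {s c : ℕ} {m : Fin s → ℕ} {q : Fin c → ℕ}

theorem eigenvector_of_similar {K ι β : Type*} [Field K] [Fintype ι] [DecidableEq ι] [Fintype β]
    {A R : Matrix ι ι K} {J : Matrix β β K} {e : β ≃ ι} (hR : R.det ≠ 0)
    (hA : A = R * J.reindex e e * R⁻¹) {v : β → K} {z : K} (hv : J *ᵥ v = z • v) :
    A *ᵥ (R *ᵥ (v ∘ e.symm)) = z • (R *ᵥ (v ∘ e.symm)) := by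
  have h1 : J.reindex e e *ᵥ (v ∘ e.symm) = z • (v ∘ e.symm) := by
    rw [reindex_apply, submatrix_mulVec_equiv]
    have : (v ∘ e.symm) ∘ e.symm.symm = v := by ext; simp
    rw [this, hv]
    rfl
  rw [hA, mulVec_mulVec, Matrix.mul_assoc, nonsing_inv_mul R (isUnit_iff_ne_zero.2 hR),
    Matrix.mul_one, ← mulVec_mulVec, h1, mulVec_smul]

theorem mulVec_comp_ne_zero {K ι β : Type*} [Field K] [Fintype ι] [DecidableEq ι]
    {R : Matrix ι ι K} (hR : R.det ≠ 0) (e : β ≃ ι) {v : β → K} (hv : v ≠ 0) :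
    R *ᵥ (v ∘ e.symm) ≠ 0 := by
  intro h
  have h1 := eq_zero_of_mulVec_eq_zero hR h
  exact hv (funext fun b => by simpa using congrFun h1 (e b))

theorem realJordanForm_mulVec_perron (x : ℝ) (lam : Fin s → ℝ) (μ : Fin c → ℂ) :
    realJordanForm x m lam q μ *ᵥ Pi.single (Sum.inl ()) 1 = x • Pi.single (Sum.inl ()) 1 := by
  ext i
  rw [mulVec_single_one]
  rcases i with _ | ⟨k, i⟩ | ⟨k, i⟩ <;> simp [realJordanForm, directSum]

theorem realJordanForm_mulVec_real (x : ℝ) (lam : Fin s → ℝ) (μ : Fin c → ℂ) (k : Fin s)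
    (hk : 0 < m k) :
    realJordanForm x m lam q μ *ᵥ Pi.single (Sum.inr (Sum.inl ⟨k, ⟨0, hk⟩⟩)) 1 =
      lam k • Pi.single (Sum.inr (Sum.inl ⟨k, ⟨0, hk⟩⟩)) 1 := by
  ext i
  rw [mulVec_single_one]
  rcases i with _ | ⟨l, i⟩ | ⟨l, i⟩
  · simp [realJordanForm, directSum]
  · by_cases hl : l = k
    · subst hl
      simp [realJordanForm, directSum, blockDiagonal'_apply, jordanBlock, Pi.single_apply]
    · simp [realJordanForm, directSum, blockDiagonal'_apply, hl]
  · simp [realJordanForm, directSum]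

/-- The vector with block `(1, i)` in the leading position of the `k`-th nonreal block. -/
noncomputable def complexEigenvector (m : Fin s → ℕ) (q : Fin c → ℕ) (k : Fin c) (hk : 0 < q k) :
    BlockIdx m q → ℂ :=
  Pi.single (Sum.inr (Sum.inr ⟨k, ⟨0, hk⟩, 0⟩)) 1 +
    Pi.single (Sum.inr (Sum.inr ⟨k, ⟨0, hk⟩, 1⟩)) I

theorem complexEigenvector_ne_zero (k : Fin c) (hk : 0 < q k) :
    complexEigenvector m q k hk ≠ 0 := by
  intro h
  have := congrFun h (Sum.inr (Sum.inr ⟨k, ⟨0, hk⟩, 0⟩))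
  simp [complexEigenvector] at this

theorem realJordanForm_mulVec_complex (x : ℝ) (lam : Fin s → ℝ) (μ : Fin c → ℂ) (k : Fin c)
    (hk : 0 < q k) :
    (realJordanForm x m lam q μ).map ofReal *ᵥ complexEigenvector m q k hk =
      μ k • complexEigenvector m q k hk := by
  ext i
  rw [complexEigenvector, mulVec_add, mulVec_single, mulVec_single]
  rcases i with _ | ⟨l, i⟩ | ⟨l, i, t⟩
  · simp [realJordanForm, directSum]
  · simp [realJordanForm, directSum]
  · by_cases hl : l = k
    · subst hl
      by_cases hi : i = ⟨0, hk⟩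
      · subst hi
        fin_cases t <;> apply Complex.ext <;>
          simp [realJordanForm, directSum, blockDiagonal'_apply, realJordanBlock, realPair]
      · simp [realJordanForm, directSum, blockDiagonal'_apply, realJordanBlock, hi]
    · simp [realJordanForm, directSum, blockDiagonal'_apply, hl]

theorem realJordanForm_perron_row (x : ℝ) (lam : Fin s → ℝ) (μ : Fin c → ℂ) (i : BlockIdx m q) :
    realJordanForm x m lam q μ (Sum.inl ()) i = if i = Sum.inl () then x else 0 := by
  rcases i with _ | ⟨k, i⟩ | ⟨k, i⟩ <;> simp [realJordanForm, directSum]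

theorem map_ofReal_mul {ι κ τ : Type*} [Fintype κ] (M : Matrix ι κ ℝ) (N : Matrix κ τ ℝ) :
    (M * N).map ofReal = M.map ofReal * N.map ofReal :=
  Matrix.map_mul (f := Complex.ofRealHom)

theorem map_ofReal_det {ι : Type*} [Fintype ι] [DecidableEq ι] (M : Matrix ι ι ℝ) :
    (M.map ofReal).det = (M.det : ℂ) :=
  (RingHom.map_det Complex.ofRealHom M).symm

theorem map_ofReal_inv {ι : Type*} [Fintype ι] [DecidableEq ι] {M : Matrix ι ι ℝ}
    (hM : M.det ≠ 0) : (M.map ofReal)⁻¹ = M⁻¹.map ofReal := by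
  refine inv_eq_right_inv ?_
  rw [← map_ofReal_mul, mul_nonsing_inv M (isUnit_iff_ne_zero.2 hM)]
  exact Matrix.map_one _ (by simp) (by simp)

/-- What Perron-Frobenius theory says about the Jordan form of a nonsingular primitive matrix: the
eigenvalues of all other blocks are nonzero and of modulus less than the spectral radius, and the
spectral projection of the Perron eigenvalue is entrywise positive. -/
theorem perron_jordan {n : ℕ} {A : Matrix (Fin n) (Fin n) ℝ} (hA : A.IsPrimitive)
    (hdet : A.det ≠ 0) (hm : ∀ k, 0 < m k) {lam : Fin s → ℝ} (hq : ∀ k, 0 < q k) {μ : Fin c → ℂ}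
    (hμ : ∀ k, (μ k).im ≠ 0) {e : BlockIdx m q ≃ Fin n} {R : Matrix (Fin n) (Fin n) ℝ}
    (hR : R.det ≠ 0) (hAR : A = R * (realJordanForm (rho A) m lam q μ).reindex e e * R⁻¹) :
    0 < rho A ∧ (∀ k, lam k ≠ 0 ∧ |lam k| < rho A) ∧ (∀ k, ‖μ k‖ < rho A) ∧
      ∀ a b, 0 < R a (e (Sum.inl ())) * R⁻¹ (e (Sum.inl ())) b := by
  set ρ := rho A with hρdef
  set J := realJordanForm ρ m lam q μ with hJ
  have hspec : ∀ z ∈ spectrum ℂ (A.map ofReal), ‖z‖ ≤ ρ := fun z hz => norm_le_rho A hz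
  have hzero : ∀ {v : Fin n → ℝ} {t : ℝ}, v ≠ 0 → A *ᵥ v = t • v → t ≠ 0 := by
    rintro v t hv h rfl
    exact hv (eq_zero_of_mulVec_eq_zero hdet (by simpa using h))
  -- the Perron vector
  set x : Fin n → ℝ := R *ᵥ ((Pi.single (Sum.inl ()) 1 : BlockIdx m q → ℝ) ∘ e.symm) with hx
  have hx0 : x ≠ 0 := mulVec_comp_ne_zero hR e (by simp)
  have hAx : A *ᵥ x = ρ • x := eigenvector_of_similar hR hAR (realJordanForm_mulVec_perron ρ lam μ)
  have hρ : 0 < ρ := lt_of_le_of_ne ENNReal.toReal_nonneg (hzero hx0 hAx).symm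
  have hxapp : ∀ a, x a = R a (e (Sum.inl ())) := by
    intro a
    have : ((Pi.single (Sum.inl ()) 1 : BlockIdx m q → ℝ) ∘ e.symm) =
        Pi.single (e (Sum.inl ())) 1 := by
      ext i
      simp [Pi.single_apply, Equiv.symm_apply_eq]
    rw [hx, this, mulVec_single_one]
    rfl
  refine ⟨hρ, fun k => ?_, fun k => ?_, fun a b => ?_⟩
  · -- a further real block of eigenvalue `ρ` would give a second Perron vector
    set v : BlockIdx m q → ℝ := Pi.single (Sum.inr (Sum.inl ⟨k, ⟨0, hm k⟩⟩)) 1 with hv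
    have hv0 : R *ᵥ (v ∘ e.symm) ≠ 0 := mulVec_comp_ne_zero hR e (by simp [hv])
    have hAv : A *ᵥ (R *ᵥ (v ∘ e.symm)) = lam k • (R *ᵥ (v ∘ e.symm)) :=
      eigenvector_of_similar hR hAR (realJordanForm_mulVec_real ρ lam μ k (hm k))
    refine ⟨hzero hv0 hAv, ?_⟩
    set w : Fin n → ℂ := fun i => ((R *ᵥ (v ∘ e.symm)) i : ℂ) with hw
    have hw0 : w ≠ 0 := fun h => hv0 (funext fun i => by simpa [hw] using congrFun h i)
    have hAw : A.map ofReal *ᵥ w = (lam k : ℂ) • w := by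
      rw [hw, map_ofReal_mulVec, hAv]
      ext i
      simp
    have hle := hspec _ (mem_spectrum_of_mulVec hw0 hAw)
    rw [Complex.norm_real, Real.norm_eq_abs] at hle
    refine lt_of_le_of_ne hle fun heq => ?_
    have h1 := (eigenvector_of_norm_eq hA hρ hspec hw0
      (by rw [Complex.norm_real, Real.norm_eq_abs, heq]) hAw).1
    rw [ofReal_inj.1 h1] at hAv
    obtain ⟨t, ht⟩ := perron_unique hA hρ hspec hx0 hAx hAv
    have h2 : R *ᵥ ((v - t • (Pi.single (Sum.inl ()) 1 : BlockIdx m q → ℝ)) ∘ e.symm) = 0 := by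
      have : (v - t • (Pi.single (Sum.inl ()) 1 : BlockIdx m q → ℝ)) ∘ e.symm =
          v ∘ e.symm - t • ((Pi.single (Sum.inl ()) 1 : BlockIdx m q → ℝ) ∘ e.symm) := rfl
      rw [this, mulVec_sub, mulVec_smul, ht, ← hx, sub_self]
    refine mulVec_comp_ne_zero hR e (fun h3 => ?_) h2
    have := congrFun h3 (Sum.inr (Sum.inl ⟨k, ⟨0, hm k⟩⟩))
    simp [hv] at this
  · have hRc : (R.map ofReal).det ≠ 0 := by
      rw [map_ofReal_det]; exact_mod_cast hR
    have hAc : A.map ofReal = R.map ofReal * (J.map ofReal).reindex e e * (R.map ofReal)⁻¹ := by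
      rw [map_ofReal_inv hR]
      conv_lhs => rw [hAR]
      rw [map_ofReal_mul, map_ofReal_mul]
      rfl
    have hv0 := mulVec_comp_ne_zero hRc e (complexEigenvector_ne_zero (m := m) k (hq k))
    have hAv := eigenvector_of_similar hRc hAc (realJordanForm_mulVec_complex ρ lam μ k (hq k))
    refine lt_of_le_of_ne (hspec _ (mem_spectrum_of_mulVec hv0 hAv)) fun heq => ?_
    have h1 := (eigenvector_of_norm_eq hA hρ hspec hv0 heq hAv).1
    exact hμ k (by rw [h1, ofReal_im])
  · -- row `y` of `R⁻¹` is a left Perron vector with `y ⬝ᵥ x = 1`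
    set y : Fin n → ℝ := fun i => R⁻¹ (e (Sum.inl ())) i with hy
    have hyx : ∑ i, y i * x i = 1 := by
      simp only [hxapp]
      have := congrFun (congrFun (nonsing_inv_mul R (isUnit_iff_ne_zero.2 hR)) (e (Sum.inl ())))
        (e (Sum.inl ()))
      simpa [mul_apply, hy] using this
    have hy0 : y ≠ 0 := by
      intro h
      simp [h] at hyx
    have hAy : Aᵀ *ᵥ y = ρ • y := by
      have h1 : R⁻¹ * A = J.reindex e e * R⁻¹ := by
        conv_lhs => rw [hAR]
        rw [← Matrix.mul_assoc, ← Matrix.mul_assoc, nonsing_inv_mul R (isUnit_iff_ne_zero.2 hR),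
          Matrix.one_mul]
      ext i
      have h2 := congrFun (congrFun h1 (e (Sum.inl ()))) i
      have h3 : (J.reindex e e * R⁻¹) (e (Sum.inl ())) i = ρ * y i := by
        rw [mul_apply]
        simp [hJ, realJordanForm_perron_row, Equiv.symm_apply_eq, hy]
      rw [h3, mul_apply] at h2
      rw [Pi.smul_apply, smul_eq_mul, ← h2]
      simp [mulVec, dotProduct, hy, mul_comm]
    have hspecT : ∀ z ∈ spectrum ℂ (Aᵀ.map ofReal), ‖z‖ ≤ ρ := by
      intro z hz
      change z ∈ spectrum ℂ (A.map ofReal)ᵀ at hz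
      rw [spectrum_transpose] at hz
      exact hspec z hz
    have hxx := perron_mul_pos hA hρ hspec hx0 hAx
    have hyy := perron_mul_pos (isPrimitive_transpose hA) hρ hspecT hy0 hAy
    rw [← hxapp]
    have hsum : x a * y b = ∑ i, (x a * x i) * (y b * y i) := by
      calc x a * y b = x a * y b * ∑ i, y i * x i := by rw [hyx, mul_one]
        _ = _ := by
          rw [Finset.mul_sum]
          exact Finset.sum_congr rfl fun i _ => by ring
    change 0 < x a * y b
    rw [hsum]
    exact Finset.sum_pos (fun i _ => mul_pos (hxx a i) (hyy b i)) ⟨a, Finset.mem_univ _⟩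

/-! ### Eventual positivity of the roots -/

theorem rootRealJordanForm_real_iff {p : ℕ} (hp : p ≠ 0) {x : ℝ} (hx : 0 < x)
    (hm : ∀ k, 0 < m k) {lam : Fin s → ℝ} (hlam : ∀ k, lam k ≠ 0) (hq : ∀ k, 0 < q k)
    {μ : Fin c → ℂ} (hμ : ∀ k, (μ k).im ≠ 0) (j₁ : Fin p) (jr : Fin s → Fin p)
    (jc : Fin c → Fin p × Fin p) :
    (∀ a b, (rootRealJordanForm p x m lam q μ j₁ jr jc a b).im = 0) ↔
      (rootPhase p j₁ x).im = 0 ∧ (∀ k, (rootPhase p (jr k) (lam k)).im = 0) ∧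
      ∀ k, rootPhase p (jc k).2 (conj (μ k)) = conj (rootPhase p (jc k).1 (μ k)) := by
  have hx' : (x : ℂ) ≠ 0 := by exact_mod_cast hx.ne'
  rw [← rootBranch_im_eq_zero_iff hx']
  have h2 := fun k => rootJordanBlock_real_iff (j := jr k) hp (hm k) (hlam k)
  have h3 := fun k => rootRealJordanBlock_real_iff (j := (jc k).1) (j' := (jc k).2) hp (hq k) (hμ k)
  simp only [← h2, ← h3]
  constructor
  · intro h
    refine ⟨h (Sum.inl ()) (Sum.inl ()), fun k a b => ?_, fun k a b => ?_⟩
    · simpa [rootRealJordanForm, directSum, blockDiagonal'_apply] using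
        h (Sum.inr (Sum.inl ⟨k, a⟩)) (Sum.inr (Sum.inl ⟨k, b⟩))
    · simpa [rootRealJordanForm, directSum, blockDiagonal'_apply] using
        h (Sum.inr (Sum.inr ⟨k, a⟩)) (Sum.inr (Sum.inr ⟨k, b⟩))
  · rintro ⟨h1, h2, h3⟩ (_ | ⟨k, i⟩ | ⟨k, i⟩) (_ | ⟨l, j⟩ | ⟨l, j⟩) <;>
      simp [rootRealJordanForm, directSum, blockDiagonal'_apply]
    · exact h1
    · split_ifs with h
      · subst h
        exact h2 k i j
      · simp
    · split_ifs with h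
      · subst h
        exact h3 k i j
      · simp

/-- Scaled by the dominant eigenvalue, the powers of the root converge to the spectral projection of
the Perron eigenvalue. -/
theorem tendsto_rootRealJordanForm_pow {p : ℕ} (hp : 0 < p) {x : ℝ} (hx : 0 < x)
    {lam : Fin s → ℝ} (hlam : ∀ k, |lam k| < x) {μ : Fin c → ℂ} (hμ : ∀ k, ‖μ k‖ < x)
    (j₁ : Fin p) (jr : Fin s → Fin p) (jc : Fin c → Fin p × Fin p) :
    Tendsto (fun k => ((rootBranch p j₁ x)⁻¹ • rootRealJordanForm p x m lam q μ j₁ jr jc) ^ k)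
      atTop (𝓝 (Matrix.single (Sum.inl ()) (Sum.inl ()) 1)) := by
  have hp' : (0 : ℝ) < 1 / p := by
    have : (0 : ℝ) < p := by exact_mod_cast hp
    positivity
  have hν0 : rootBranch p j₁ x ≠ 0 := by
    rw [← norm_pos_iff, norm_rootBranch]
    exact Real.rpow_pos_of_pos (by simpa using hx.ne') _
  have hlt : ∀ (j : ℕ) {z : ℂ}, ‖z‖ < x → ‖rootBranch p j z‖ < ‖rootBranch p j₁ x‖ := by
    intro j z hz
    rw [norm_rootBranch, norm_rootBranch, Complex.norm_real, Real.norm_of_nonneg hx.le]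
    exact Real.rpow_lt_rpow (norm_nonneg _) hz hp'
  simp only [rootRealJordanForm, smul_directSum, directSum_pow, inv_mul_cancel₀ hν0, one_pow]
  exact tendsto_directSum
    (fun k => tendsto_rootJordanBlock_pow (hlt _ (by simpa using hlam k)))
    (fun k => tendsto_rootRealJordanBlock_pow (hlt _ (hμ k))
      (hlt _ (by rw [RCLike.norm_conj]; exact hμ k)))

/-- A real matrix whose scaled powers `t⁻ᵏ Bᵏ` converge to a positive matrix is eventually positive
iff `t` is positive. -/
theorem eventuallyPositive_iff_of_tendsto {n : ℕ} {B E : Matrix (Fin n) (Fin n) ℝ} {t : ℝ}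
    (ht : t ≠ 0) (a₀ : Fin n) (hE : ∀ a b, 0 < E a b)
    (h : Tendsto (fun k => (t⁻¹ • B) ^ k) atTop (𝓝 E)) : EventuallyPositive B ↔ 0 < t := by
  have hev : ∀ᶠ k in atTop, ∀ a b, 0 < (t ^ k)⁻¹ * (B ^ k) a b := by
    rw [eventually_all]
    intro a
    rw [eventually_all]
    intro b
    have h1 := tendsto_pi_nhds.1 (tendsto_pi_nhds.1 h a) b
    filter_upwards [h1.eventually_const_lt (hE a b)] with k hk
    simpa [smul_pow] using hk
  obtain ⟨N, hN⟩ := eventually_atTop.1 hev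
  constructor
  · rintro ⟨M, hM⟩
    by_contra hneg
    have ht' : t < 0 := lt_of_le_of_ne (not_lt.1 hneg) ht
    -- for a large odd exponent `t ^ k < 0` and `0 < (t ^ k)⁻¹ * (B ^ k) a a` force `B ^ k` negative
    set k := 2 * (N + M) + 1 with hk
    have h1 := hN k (by omega) a₀ a₀
    have h2 := hM k (by omega) a₀ a₀
    have h3 : t ^ k < 0 := Odd.pow_neg ⟨N + M, hk⟩ ht'
    exact absurd h1 (not_lt.2 (mul_nonpos_of_nonpos_of_nonneg (inv_nonpos.2 h3.le) h2.le))
  · intro htpos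
    refine ⟨N, fun k hk a b => ?_⟩
    exact (mul_pos_iff_of_pos_left (inv_pos.2 (pow_pos htpos k))).1 (hN k hk a b)

theorem rootBranch_pos_iff {p j : ℕ} (hj : j < p) {x : ℝ} (hx : 0 < x)
    (him : (rootPhase p j x).im = 0) : 0 < (rootBranch p j x).re ↔ j = 0 := by
  have hpos : (0 : ℝ) < ‖(x : ℂ)‖ ^ ((1 : ℝ) / p) :=
    Real.rpow_pos_of_pos (by simpa using hx.ne') _
  rw [rootBranch_eq, Complex.re_ofReal_mul, mul_pos_iff_of_pos_left hpos]
  rcases (rootPhase_ofReal_pos hj hx).1 him with rfl | h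
  · simp [rootPhase, Complex.arg_ofReal_of_nonneg hx.le]
  · have hj0 : j ≠ 0 := by omega
    have h1 : rootPhase p j x = -1 := by
      have hp : (p : ℂ) ≠ 0 := by
        have : p ≠ 0 := by omega
        exact_mod_cast this
      rw [rootPhase, Complex.arg_ofReal_of_nonneg hx.le, ← Complex.exp_pi_mul_I]
      congr 1
      have : (p : ℂ) = 2 * j := by exact_mod_cast h.symm
      field_simp
      rw [this]
      push_cast
      ring
    rw [h1]
    simp only [hj0, iff_false]
    norm_num

/-- The root is eventually positive iff its Perron branch is principal and all blocks are real. -/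
theorem isEventuallyPositive_iff {n p : ℕ} (hp : 1 < p)
    {A : Matrix (Fin n) (Fin n) ℝ} (hA : A.IsPrimitive) (hdet : A.det ≠ 0)
    (hm : ∀ k, 0 < m k) {lam : Fin s → ℝ} (hq : ∀ k, 0 < q k) {μ : Fin c → ℂ}
    (hμ : ∀ k, (μ k).im ≠ 0) {e : BlockIdx m q ≃ Fin n} {R : Matrix (Fin n) (Fin n) ℝ}
    (hR : R.det ≠ 0) (hAR : A = R * (realJordanForm (rho A) m lam q μ).reindex e e * R⁻¹)
    {j₁ : Fin p} {jr : Fin s → Fin p} {jc : Fin c → Fin p × Fin p}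
    {X : Matrix (Fin n) (Fin n) ℂ}
    (hX : X = R.map Complex.ofReal *
      (rootRealJordanForm p (rho A) m lam q μ j₁ jr jc).reindex e e *
        (R.map Complex.ofReal)⁻¹) :
    IsEventuallyPositive X ↔ (j₁ : ℕ) = 0 ∧ (∀ k, (rootPhase p (jr k) (lam k)).im = 0) ∧
      ∀ k, rootPhase p (jc k).2 (conj (μ k)) = conj (rootPhase p (jc k).1 (μ k)) := by
  obtain ⟨hρ, hlam, hμlt, hE⟩ := perron_jordan hA hdet hm hq hμ hR hAR
  set Y := rootRealJordanForm p (rho A) m lam q μ j₁ jr jc with hY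
  have hcanc : (R.map ofReal)⁻¹ * R.map ofReal = 1 := nonsing_inv_mul _
    (isUnit_iff_ne_zero.2 (by rw [map_ofReal_det]; exact_mod_cast hR))
  have hcanc' : R.map ofReal * (R.map ofReal)⁻¹ = 1 := mul_eq_one_comm.1 hcanc
  have hreal := rootRealJordanForm_real_iff (q := q) (m := m) (by omega : p ≠ 0) hρ hm
    (fun k => (hlam k).1) hq hμ j₁ jr jc
  -- a real `X` has a real Jordan part
  have hXreal : ∀ B : Matrix (Fin n) (Fin n) ℝ, X = B.map ofReal → ∀ a b, (Y a b).im = 0 := by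
    intro B hB a b
    have h1 : Y.reindex e e = (R⁻¹ * B * R).map ofReal := by
      rw [map_ofReal_mul, map_ofReal_mul, ← hB, ← map_ofReal_inv hR, hX]
      simp only [Matrix.mul_assoc, hcanc, Matrix.mul_one]
      rw [← Matrix.mul_assoc, hcanc, Matrix.one_mul]
    have h2 := congrFun (congrFun h1 (e a)) (e b)
    simp only [reindex_apply, submatrix_apply, Equiv.symm_apply_apply, map_apply] at h2
    rw [h2, ofReal_im]
  -- for a real `X` the sign of the dominant eigenvalue decides
  have hsign : ∀ B : Matrix (Fin n) (Fin n) ℝ, X = B.map ofReal → (rootPhase p j₁ (rho A)).im = 0 →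
      (EventuallyPositive B ↔ (j₁ : ℕ) = 0) := by
    intro B hB him
    have hρ' : ((rho A : ℝ) : ℂ) ≠ 0 := by exact_mod_cast hρ.ne'
    set t := (rootBranch p j₁ (rho A)).re with ht
    have hν : rootBranch p j₁ (rho A) = (t : ℂ) :=
      Complex.ext rfl (by simpa using (rootBranch_im_eq_zero_iff hρ').2 him)
    have ht0 : t ≠ 0 := by
      intro h0
      rw [h0] at hν
      have := norm_rootBranch p j₁ (rho A)
      rw [hν] at this
      have h3 : (0 : ℝ) < ‖((rho A : ℝ) : ℂ)‖ ^ ((1 : ℝ) / p) :=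
        Real.rpow_pos_of_pos (norm_pos_iff.2 hρ') _
      simp only [ofReal_zero, norm_zero] at this
      exact h3.ne this
    rw [← rootBranch_pos_iff j₁.2 hρ him]
    refine eventuallyPositive_iff_of_tendsto ht0 (e (Sum.inl ())) hE
      (E := fun a b => R a (e (Sum.inl ())) * R⁻¹ (e (Sum.inl ())) b) ?_
    have hlim := tendsto_rootRealJordanForm_pow (m := m) (q := q) (by omega : 0 < p) hρ
      (fun k => (hlam k).2) hμlt j₁ jr jc
    rw [← hY, hν] at hlim
    have hpow : ∀ k, ((t⁻¹ • B) ^ k).map ofReal =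
        R.map ofReal * (((t : ℂ)⁻¹ • Y) ^ k).submatrix e.symm e.symm * (R.map ofReal)⁻¹ := by
      intro k
      have h1 : (t⁻¹ • B).map ofReal =
          R.map ofReal * ((t : ℂ)⁻¹ • Y).submatrix e.symm e.symm * (R.map ofReal)⁻¹ := by
        have : (t⁻¹ • B).map ofReal = (t : ℂ)⁻¹ • B.map ofReal := by
          ext a b
          simp
        have hYs : ((t : ℂ)⁻¹ • Y).submatrix e.symm e.symm =
            (t : ℂ)⁻¹ • Y.submatrix e.symm e.symm := rfl
        rw [this, ← hB, hX, reindex_apply, hYs, Matrix.mul_smul, Matrix.smul_mul]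
      have h2 : (((t : ℂ)⁻¹ • Y) ^ k).submatrix e.symm e.symm =
          (((t : ℂ)⁻¹ • Y).submatrix e.symm e.symm) ^ k :=
        map_pow (Matrix.reindexAlgEquiv ℂ ℂ e) ((t : ℂ)⁻¹ • Y) k
      rw [map_ofReal_pow, h1, mul_mul_pow hcanc' hcanc, h2]
    refine tendsto_pi_nhds.2 fun a => tendsto_pi_nhds.2 fun b => ?_
    have hc : Continuous fun D : Matrix (BlockIdx m q) (BlockIdx m q) ℂ =>
        ((R.map ofReal * D.submatrix e.symm e.symm * (R.map ofReal)⁻¹) a b).re := by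
      refine Complex.continuous_re.comp (Continuous.matrix_elem ?_ a b)
      exact (continuous_const.matrix_mul (continuous_id.matrix_submatrix _ _)).matrix_mul
        continuous_const
    have h1 := (hc.tendsto _).comp hlim
    have h2 : ((R.map ofReal * (Matrix.single (Sum.inl ()) (Sum.inl ()) (1 : ℂ) :
        Matrix (BlockIdx m q) (BlockIdx m q) ℂ).submatrix e.symm e.symm * (R.map ofReal)⁻¹) a b).re
        = R a (e (Sum.inl ())) * R⁻¹ (e (Sum.inl ())) b := by
      have : (Matrix.single (Sum.inl ()) (Sum.inl ()) (1 : ℂ) :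
          Matrix (BlockIdx m q) (BlockIdx m q) ℂ).submatrix e.symm e.symm =
          Matrix.single (e (Sum.inl ())) (e (Sum.inl ())) 1 := by
        ext i j
        simp [Matrix.single_apply, Equiv.eq_symm_apply]
      rw [this, map_ofReal_inv hR]
      simp [mul_apply, Matrix.single_apply, ite_and, ← ofReal_mul]
    rw [h2] at h1
    refine h1.congr fun k => ?_
    simp only [Function.comp_apply]
    rw [← hpow, map_apply, ofReal_re]
  constructor
  · rintro ⟨B, hB, hBpos⟩
    obtain ⟨him, h2, h3⟩ := hreal.1 (hXreal B hB)
    exact ⟨(hsign B hB him).1 hBpos, h2, h3⟩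
  · rintro ⟨hj, h2, h3⟩
    have him : (rootPhase p j₁ (rho A)).im = 0 := (rootPhase_ofReal_pos j₁.2 hρ).2 (Or.inl hj)
    have hYr := hreal.2 ⟨him, h2, h3⟩
    set B := R * ((Y.map Complex.re).reindex e e) * R⁻¹ with hB
    have hXB : X = B.map ofReal := by
      rw [hB, map_ofReal_mul, map_ofReal_mul, hX, ← map_ofReal_inv hR]
      congr 2
      ext a b
      exact Complex.ext rfl (by simpa using hYr _ _)
    exact ⟨B, hXB, (hsign B hXB him).2 hj⟩

end

end MatrixRoot

theorem theorem3p5 {n s c : ℕ} (p : ℕ) (hp : 1 < p)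
    (A : Matrix (Fin n) (Fin n) ℝ) (hA : A.IsPrimitive) (hdet : A.det ≠ 0)
    -- the real Jordan canonical form of `A`, the block of the Perron eigenvalue listed separately
    (m : Fin s → ℕ) (hm : ∀ k, 0 < m k) (lam : Fin s → ℝ)
    (q : Fin c → ℕ) (hq : ∀ k, 0 < q k) (μ : Fin c → ℂ) (hμ : ∀ k, (μ k).im ≠ 0)
    (e : BlockIdx m q ≃ Fin n) (R : Matrix (Fin n) (Fin n) ℝ) (hR : R.det ≠ 0)
    (hAR : A = R * (realJordanForm (rho A) m lam q μ).reindex e e * R⁻¹)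
    -- the primary root `X` given by a choice of branches
    (j₁ : Fin p) (jr : Fin s → Fin p) (jc : Fin c → Fin p × Fin p)
    (hprim : IsPrimaryChoice (rho A) lam μ j₁ jr jc)
    (X : Matrix (Fin n) (Fin n) ℂ)
    (hX : X = R.map Complex.ofReal *
      (rootRealJordanForm p (rho A) m lam q μ j₁ jr jc).reindex e e *
        (R.map Complex.ofReal)⁻¹) :
    (Odd p →
      (IsEventuallyPositive X ↔
        (j₁ : ℕ) = 0 ∧
        (∀ k, (0 < lam k → (jr k : ℕ) = 0) ∧ (lam k < 0 → (jr k : ℕ) = (p - 1) / 2)) ∧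
        (∀ k, (((jc k).1 : ℕ) = 0 ∧ ((jc k).2 : ℕ) = 0) ∨
          ((jc k).1 : ℕ) + ((jc k).2 : ℕ) = p))) ∧
    (Even p → (∀ k, 0 < lam k) →
      (IsEventuallyPositive X ↔
        (j₁ : ℕ) = 0 ∧
        (∀ k, (jr k : ℕ) = 0 ∨ (jr k : ℕ) = p / 2) ∧
        (∀ k, (((jc k).1 : ℕ) = 0 ∧ ((jc k).2 : ℕ) = 0) ∨
          ((jc k).1 : ℕ) + ((jc k).2 : ℕ) = p))) ∧
    (Even p → (∃ k, lam k < 0) → ¬ IsEventuallyPositive X) := by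
  have hlam : ∀ k, lam k ≠ 0 := fun k => ((perron_jordan hA hdet hm hq hμ hR hAR).2.1 k).1
  rw [isEventuallyPositive_iff hp hA hdet hm hq hμ hR hAR hX]
  have hc : ∀ k, rootPhase p (jc k).2 (conj (μ k)) = conj (rootPhase p (jc k).1 (μ k)) ↔ _ :=
    fun k => rootPhase_conj (jc k).1.2 (jc k).2.2 (hμ k)
  simp only [hc]
  refine ⟨fun hodd => ?_, fun heven hpos => ?_, ?_⟩
  · refine and_congr_right fun _ => and_congr_left fun _ => forall_congr' fun k => ?_
    obtain ⟨d, hd⟩ := hodd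
    rcases lt_or_gt_of_ne (hlam k) with h | h
    · rw [rootPhase_ofReal_neg (jr k).2 h]
      simp only [h, not_lt.2 h.le, false_imp_iff, true_imp_iff, true_and]
      omega
    · rw [rootPhase_ofReal_pos (jr k).2 h]
      simp only [h, not_lt.2 h.le, false_imp_iff, true_imp_iff, and_true]
      omega
  · refine and_congr_right fun _ => and_congr_left fun _ => forall_congr' fun k => ?_
    obtain ⟨d, hd⟩ := heven
    rw [rootPhase_ofReal_pos (jr k).2 (hpos k)]
    omega
  · rintro ⟨d, hd⟩ ⟨k, hk⟩ ⟨-, h, -⟩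
    have := (rootPhase_ofReal_neg (jr k).2 hk).1 (h k)
    omega
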